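/- Let $\Lambda,\Omega$ be countably infinite sets, let $\mathcal F$ be a nonempty family of infinite subsets of $\Omega$ such that $F\setminus K\in\mathcal F$ for all $F\in\mathcal F$ and all finite $K\subseteq\Omega$, and let $\rho$ be a function assigning to each $F\in\mathcal F$ an infinite set $\rho(F)\subseteq\Lambda$. Assume that $\rho$ is *partition regular*, that is: - (M) if $E,F\in\mathcal F$ and $E\subseteq F$, then $\rho(E)\subseteq\rho(F)$; - (R) if $F\in\mathcal F$ and $\rho(F)=A\cup B$, then there is $E\in\mathcal F$ with $\rho(E)\subseteq A$ or $\rho(E)\subseteq B$; - (S) for every $E\in\mathcal F$ there is $F\in\mathcal F$ with $F\subseteq E$ such that for every $a\in\rho(F)$ there is a finite $K\subseteq\Omega$ with $a\notin\rho(F\setminus K)$. Put $\mathcal I_\rho=\{A\subseteq\Lambda:\rho(F)\not\subseteq A\text{ for all }F\in\mathcal F\}$. We say that $\rho$ *has small accretions* if for every $E\in\mathcal F$ there is $F\in\mathcal F$ with $F\subseteq E$ such that $\rho(F)\setminus\rho(F\setminus K)\in\mathcal I_\rho$ for every finite $K\subseteq\Omega$. We write $\rho\in P^-$ if for every decreasing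 sequence $A_0\supseteq A_1\supseteq\cdots$ of subsets of $\Lambda$ with $A_0\notin\mathcal I_\rho$ and $A_n\setminus A_{n+1}\in\mathcal I_\rho$ for all $n$ there is $F\in\mathcal F$ such that $\rho(F)\subseteq A_0$ and for each $n$ there is a finite $K\subseteq\Omega$ with $\rho(F\setminus K)\subseteq A_n$. A topological space $X$ belongs to $\mathrm{FinBW}(\rho)$ if for every $f:\Lambda\to X$ there are $F\in\mathcal F$ and $x\in X$ such that for every neighbourhood $U$ of $x$ there is a finite $K\subseteq\Omega$ with $f[\rho(F\setminus K)]\subseteq U$. Let $\mathrm{conv}$ be the family of all subsets of $\mathbb Q\cap[0,1]$ that can be covered by the ranges of finitely many sequences in $\mathbb Q\cap[0,1]$ convergent in $[0,1]$. We write $\rho_{\mathrm{conv}}\le_K\rho$ if there is a function $f:\Lambda\to\mathbb Q\cap[0,1]$ such that for every $F_1\in\mathcal F$ there is $F_2\subseteq\mathbb Q\cap[0,1]$ with $F_2\notin\mathrm{conv}$ such that for every finite $K_1\subseteq\Omega$ there is a finite $K_2\subseteq\mathbb Q\cap[0,1]$ with $F_2\setminus K_2\subseteq f[\rho(F_1\setminus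 K_1)]$. (This is the Katětov order between $\rho$ and the function $\rho_{\mathrm{conv}}(A)=A$ defined on the sets $A\notin\mathrm{conv}$.) **Theorem.** Let $\rho$ be partition regular with small accretions. If moreover $\rho\in P^-$, then the following conditions are equivalent: 1. for every metric space $X$: $X\in\mathrm{FinBW}(\rho)$ if and only if $X$ is compact; 2. $[0,1]\in\mathrm{FinBW}(\rho)$; 3. $\rho_{\mathrm{conv}}\not\le_K\rho$. The assumption $\rho\in P^-$ is used only for $(3)\Rightarrow(2)$: without it, $(1)\Leftrightarrow(2)$ and $(2)\Rightarrow(3)$ still hold. -/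

import Mathlib

open Set Filter Topology

universe u v w

/-- A partial function `ρ : 𝓕 → [Λ]^ω` with `𝓕 ⊆ [Ω]^ω` is represented by its domain `𝓕` and a map
`ρ : Set Ω → Set Λ`, of which only the values on `𝓕` are ever used.
`IsPartitionRegular 𝓕 ρ` says that `𝓕` is a nonempty family of infinite sets closed under removing
finite sets, that `ρ` takes infinite values on `𝓕`, and that (M), (R) and (S) hold. -/
structure IsPartitionRegular {Ω Λ : Type*} (𝓕 : Set (Set Ω)) (ρ : Set Ω → Set Λ) : Prop where
  nonempty : 𝓕.Nonempty
  infinite_mem : ∀ F ∈ 𝓕, F.Infinite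
  diff_mem : ∀ F ∈ 𝓕, ∀ K : Finset Ω, F \ (K : Set Ω) ∈ 𝓕
  infinite_value : ∀ F ∈ 𝓕, (ρ F).Infinite
  /-- property (M) -/
  mono : ∀ E ∈ 𝓕, ∀ F ∈ 𝓕, E ⊆ F → ρ E ⊆ ρ F
  /-- property (R) -/
  ramsey : ∀ F ∈ 𝓕, ∀ A B : Set Λ, ρ F = A ∪ B → ∃ E ∈ 𝓕, ρ E ⊆ A ∨ ρ E ⊆ B
  /-- property (S) -/
  sparse : ∀ E ∈ 𝓕, ∃ F ∈ 𝓕, F ⊆ E ∧ ∀ a ∈ ρ F, ∃ K : Finset Ω, a ∉ ρ (F \ (K : Set Ω))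

/-- The ideal `I_ρ = {A ⊆ Λ : ρ(F) ⊄ A for all F ∈ 𝓕}`. -/
def rhoIdeal {Ω Λ : Type*} (𝓕 : Set (Set Ω)) (ρ : Set Ω → Set Λ) : Set (Set Λ) :=
  {A | ∀ F ∈ 𝓕, ¬ ρ F ⊆ A}

/-- A single set `F` has small accretions. -/
def SetHasSmallAccretions {Ω Λ : Type*} (𝓕 : Set (Set Ω)) (ρ : Set Ω → Set Λ) (F : Set Ω) : Prop :=
  ∀ K : Finset Ω, ρ F \ ρ (F \ (K : Set Ω)) ∈ rhoIdeal 𝓕 ρ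

/-- `ρ` has small accretions. -/
def HasSmallAccretions {Ω Λ : Type*} (𝓕 : Set (Set Ω)) (ρ : Set Ω → Set Λ) : Prop :=
  ∀ E ∈ 𝓕, ∃ F ∈ 𝓕, F ⊆ E ∧ SetHasSmallAccretions 𝓕 ρ F

/-- The property `ρ ∈ P⁻`. -/
def PMinus {Ω Λ : Type*} (𝓕 : Set (Set Ω)) (ρ : Set Ω → Set Λ) : Prop :=
  ∀ A : ℕ → Set Λ, Antitone A → A 0 ∉ rhoIdeal 𝓕 ρ →
    (∀ n, A n \ A (n + 1) ∈ rhoIdeal 𝓕 ρ) →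
    ∃ F ∈ 𝓕, ρ F ⊆ A 0 ∧ ∀ n, ∃ K : Finset Ω, ρ (F \ (K : Set Ω)) ⊆ A n

/-- `f ↾ ρ(F)` is `ρ`-convergent to `x`. -/
def RhoConvergesTo {Ω Λ X : Type*} [TopologicalSpace X] (ρ : Set Ω → Set Λ) (f : Λ → X)
    (F : Set Ω) (x : X) : Prop :=
  ∀ U ∈ 𝓝 x, ∃ K : Finset Ω, f '' ρ (F \ (K : Set Ω)) ⊆ U

/-- The topological space `X` belongs to the class `FinBW(ρ)`. -/
def FinBW {Ω Λ : Type*} (𝓕 : Set (Set Ω)) (ρ : Set Ω → Set Λ) (X : Type*) [TopologicalSpace X] :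
    Prop :=
  ∀ f : Λ → X, ∃ F ∈ 𝓕, ∃ x : X, RhoConvergesTo ρ f F x

/-- The Katětov order: `KatetovLE 𝓕₂ ρ₂ 𝓕₁ ρ₁` means `ρ₂ ≤_K ρ₁`. -/
def KatetovLE {Ω₁ Λ₁ Ω₂ Λ₂ : Type*} (𝓕₂ : Set (Set Ω₂)) (ρ₂ : Set Ω₂ → Set Λ₂)
    (𝓕₁ : Set (Set Ω₁)) (ρ₁ : Set Ω₁ → Set Λ₁) : Prop :=
  ∃ f : Λ₁ → Λ₂, ∀ F₁ ∈ 𝓕₁, ∃ F₂ ∈ 𝓕₂, ∀ K₁ : Finset Ω₁, ∃ K₂ : Finset Ω₂,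
    ρ₂ (F₂ \ (K₂ : Set Ω₂)) ⊆ f '' ρ₁ (F₁ \ (K₁ : Set Ω₁))

/-- The coideal `I⁺`, i.e. the domain of the function `ρ_I`. -/
def coideal {Λ : Type*} (I : Set (Set Λ)) : Set (Set Λ) :=
  {A | A ∉ I}

/-- The function `ρ_I : I⁺ → [Λ]^ω`, `ρ_I(A) = A`; its domain is `coideal I`. -/
def rhoOfIdeal {Λ : Type*} (_I : Set (Set Λ)) : Set Λ → Set Λ :=
  fun A => A

/-- The ideal `conv` on `ℚ ∩ [0,1]`: the sets covered by the ranges of finitely many sequences in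
`ℚ ∩ [0,1]` that converge in the real interval `[0,1]`. -/
def convIdeal : Set (Set (Icc (0 : ℚ) 1)) :=
  {A | ∃ (n : ℕ) (s : Fin n → ℕ → Icc (0 : ℚ) 1),
    (∀ i, ∃ p ∈ Icc (0 : ℝ) 1, Tendsto (fun k => (((s i k : ℚ)) : ℝ)) atTop (𝓝 p)) ∧
    A ⊆ ⋃ i, range (s i)}

section

variable {Ω Λ : Type*} {𝓕 : Set (Set Ω)} {ρ : Set Ω → Set Λ}

/-! `FinBW` passes to closed subspaces and continuous images, so [0,1] yields the Cantor set and
then every compact metric space. Conversely, enumerating Λ turns `FinBW` into sequential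
compactness. A ρ-limit of a rational-valued f forces any Katětov witness F₂ into `conv`, since F₂ is
almost contained in each neighbourhood of the limit. For the remaining implication, take f without
ρ-limits and make it rational by (S). In `rhoClusterSet`, P⁻ turns an isolated point into a ρ-limit,
so with compactness the set is infinite. Small accretions make its points accumulate the image of
ρ(F \ K) for every finite K. A diagonal sequence through these images then has infinitely many
accumulation points, so its range is outside `conv` and witnesses the Katětov reduction. -/

theorem rhoIdeal_mono {A B : Set Λ} (hB : B ∈ rhoIdeal 𝓕 ρ) (h : A ⊆ B) : A ∈ rhoIdeal 𝓕 ρ :=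
  fun F hF hA => hB F hF (hA.trans h)

theorem IsPartitionRegular.union_mem_rhoIdeal (hρ : IsPartitionRegular 𝓕 ρ) {A B : Set Λ}
    (hA : A ∈ rhoIdeal 𝓕 ρ) (hB : B ∈ rhoIdeal 𝓕 ρ) : A ∪ B ∈ rhoIdeal 𝓕 ρ := by
  intro F hF h
  obtain ⟨E, hE, h' | h'⟩ := hρ.ramsey F hF (ρ F ∩ A) (ρ F ∩ B)
    (by rw [← inter_union_distrib_left, inter_eq_left.2 h])
  · exact hA E hE (h'.trans inter_subset_right)
  · exact hB E hE (h'.trans inter_subset_right)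

theorem IsPartitionRegular.empty_mem_rhoIdeal (hρ : IsPartitionRegular 𝓕 ρ) :
    (∅ : Set Λ) ∈ rhoIdeal 𝓕 ρ := by
  intro F hF h
  exact hρ.infinite_value F hF (finite_empty.subset h)

theorem value_notMem_rhoIdeal {F : Set Ω} (hF : F ∈ 𝓕) : ρ F ∉ rhoIdeal 𝓕 ρ :=
  fun h => h F hF subset_rfl

theorem IsPartitionRegular.value_diff_subset (hρ : IsPartitionRegular 𝓕 ρ) {E F : Set Ω}
    (hE : E ∈ 𝓕) (hF : F ∈ 𝓕) (h : E ⊆ F) {K L : Finset Ω} (hKL : L ⊆ K) :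
    ρ (E \ (K : Set Ω)) ⊆ ρ (F \ (L : Set Ω)) :=
  hρ.mono _ (hρ.diff_mem _ hE K) _ (hρ.diff_mem _ hF L)
    (sdiff_subset_sdiff h (Finset.coe_subset.2 hKL))

theorem IsPartitionRegular.value_diff_subset_self (hρ : IsPartitionRegular 𝓕 ρ) {F : Set Ω}
    (hF : F ∈ 𝓕) (K : Finset Ω) : ρ (F \ (K : Set Ω)) ⊆ ρ F :=
  hρ.mono _ (hρ.diff_mem _ hF K) _ hF sdiff_subset

theorem IsPartitionRegular.rhoConvergesTo_mono {X : Type*} [TopologicalSpace X]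
    (hρ : IsPartitionRegular 𝓕 ρ) {f : Λ → X} {E F : Set Ω} (hE : E ∈ 𝓕) (hF : F ∈ 𝓕)
    (h : E ⊆ F) {x : X} (hx : RhoConvergesTo ρ f F x) : RhoConvergesTo ρ f E x := by
  intro U hU
  obtain ⟨K, hK⟩ := hx U hU
  exact ⟨K, (image_mono (hρ.value_diff_subset hE hF h subset_rfl)).trans hK⟩

theorem RhoConvergesTo.comp {X Y : Type*} [TopologicalSpace X] [TopologicalSpace Y] {f : Λ → X}
    {F : Set Ω} {x : X} (h : RhoConvergesTo ρ f F x) {g : X → Y} (hg : ContinuousAt g x) :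
    RhoConvergesTo ρ (g ∘ f) F (g x) := by
  intro U hU
  obtain ⟨K, hK⟩ := h _ (hg hU)
  exact ⟨K, by rw [image_comp]; exact image_subset_iff.2 hK⟩

/-- Under (S), finitely many points of `Λ` can be removed from the value on a set. -/
theorem IsPartitionRegular.exists_value_diff_disjoint (hρ : IsPartitionRegular 𝓕 ρ) {F : Set Ω}
    (hF : F ∈ 𝓕) (hS : ∀ a ∈ ρ F, ∃ K : Finset Ω, a ∉ ρ (F \ (K : Set Ω))) (K : Finset Ω)
    {T : Set Λ} (hT : T.Finite) :
    ∃ L : Finset Ω, K ⊆ L ∧ ∀ a ∈ ρ (F \ (L : Set Ω)), a ∉ T := by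
  classical
  have h (a : Λ) : ∃ K : Finset Ω, a ∉ ρ (F \ (K : Set Ω)) := by
    by_cases ha : a ∈ ρ F
    · exact hS a ha
    · exact ⟨∅, fun h => ha (hρ.value_diff_subset_self hF _ h)⟩
  choose k hk using h
  refine ⟨K ∪ hT.toFinset.biUnion k, Finset.subset_union_left, fun a ha haT => hk a ?_⟩
  refine hρ.value_diff_subset hF hF subset_rfl ?_ ha
  exact (Finset.subset_biUnion_of_mem k (hT.mem_toFinset.2 haT)).trans Finset.subset_union_right

/-! ### Transfer of `FinBW` and compact metric spaces -/

theorem FinBW.of_surjective {X Y : Type*} [TopologicalSpace X] [TopologicalSpace Y]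
    (h : FinBW 𝓕 ρ X) {g : X → Y} (hg : Continuous g) (hs : g.Surjective) : FinBW 𝓕 ρ Y := by
  intro f
  obtain ⟨F, hF, x, hx⟩ := h (Function.surjInv hs ∘ f)
  refine ⟨F, hF, g x, ?_⟩
  have := hx.comp hg.continuousAt
  rwa [← Function.comp_assoc, Function.comp_surjInv hs, Function.id_comp] at this

theorem IsPartitionRegular.finBW_of_isClosedEmbedding (hρ : IsPartitionRegular 𝓕 ρ)
    {X Y : Type*} [TopologicalSpace X] [TopologicalSpace Y]
    (h : FinBW 𝓕 ρ Y) {g : X → Y} (hg : IsClosedEmbedding g) : FinBW 𝓕 ρ X := by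
  intro f
  obtain ⟨F, hF, y, hy⟩ := h (g ∘ f)
  have hmem : y ∈ range g := by
    rw [← hg.isClosed_range.closure_eq, mem_closure_iff_nhds]
    intro U hU
    obtain ⟨K, hK⟩ := hy U hU
    obtain ⟨a, ha⟩ := (hρ.infinite_value _ (hρ.diff_mem F hF K)).nonempty
    exact ⟨g (f a), hK (mem_image_of_mem _ ha), mem_range_self _⟩
  obtain ⟨x, rfl⟩ := hmem
  refine ⟨F, hF, x, fun U hU => ?_⟩
  rw [hg.isInducing.nhds_eq_comap, mem_comap] at hU
  obtain ⟨V, hV, hVU⟩ := hU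
  obtain ⟨K, hK⟩ := hy V hV
  refine ⟨K, ?_⟩
  rintro _ ⟨a, ha, rfl⟩
  exact hVU (hK (mem_image_of_mem _ ha))

theorem IsPartitionRegular.compactSpace_of_finBW [Countable Λ] [Infinite Λ]
    (hρ : IsPartitionRegular 𝓕 ρ) {X : Type*} [MetricSpace X] (h : FinBW 𝓕 ρ X) :
    CompactSpace X := by
  rw [compactSpace_iff_seqCompactSpace]
  refine ⟨fun u _ => ?_⟩
  obtain ⟨e⟩ : Nonempty (Λ ≃ ℕ) := nonempty_equiv_of_countable
  obtain ⟨F, hF, x, hx⟩ := h (u ∘ e)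
  -- Values of ρ are infinite, so their images under `e` are infinite sets of indices.
  have hc : MapClusterPt x atTop u := by
    rw [mapClusterPt_iff_frequently]
    intro U hU
    obtain ⟨K, hK⟩ := hx U hU
    rw [Nat.frequently_atTop_iff_infinite]
    refine ((hρ.infinite_value _ (hρ.diff_mem F hF K)).image e.injective.injOn).mono ?_
    rintro _ ⟨a, ha, rfl⟩
    exact hK (mem_image_of_mem _ ha)
  obtain ⟨φ, hφ, hlim⟩ := hc.tendsto_subseq
  exact ⟨x, mem_univ _, φ, hφ, hlim⟩

theorem IsPartitionRegular.finBW_of_compactSpace [Infinite Λ] (hρ : IsPartitionRegular 𝓕 ρ)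
    (h : FinBW 𝓕 ρ (Icc (0 : ℝ) 1)) (X : Type*) [MetricSpace X] [CompactSpace X] :
    FinBW 𝓕 ρ X := by
  rcases isEmpty_or_nonempty X with hX | hX
  · intro f
    exact (hX.false (f (Classical.arbitrary Λ))).elim
  obtain ⟨g, hg, hs⟩ := exists_nat_bool_continuous_surjective_of_compact X
  have hemb : IsClosedEmbedding (inclusion cantorSet_subset_unitInterval) :=
    (IsClosedEmbedding.of_comp_iff isClosed_Icc.isClosedEmbedding_subtypeVal).1
      isClosed_cantorSet.isClosedEmbedding_subtypeVal
  exact (hρ.finBW_of_isClosedEmbedding h hemb).of_surjective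
    (hg.comp cantorSetHomeomorphNatToBool.continuous)
    (hs.comp cantorSetHomeomorphNatToBool.surjective)

theorem IsPartitionRegular.forall_finBW_iff_compactSpace_iff [Countable Λ] [Infinite Λ]
    (hρ : IsPartitionRegular 𝓕 ρ) :
    (∀ (X : Type w) [MetricSpace X], FinBW 𝓕 ρ X ↔ CompactSpace X) ↔
      FinBW 𝓕 ρ (Icc (0 : ℝ) 1) := by
  refine ⟨fun h => ?_, fun h X _ =>
    ⟨hρ.compactSpace_of_finBW, fun _ => hρ.finBW_of_compactSpace h X⟩⟩
  -- The universe of X is arbitrary, so [0,1] has to be lifted into it.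
  have : FinBW 𝓕 ρ (ULift.{w} (Icc (0 : ℝ) 1)) := (h _).2 inferInstance
  exact this.of_surjective continuous_uliftDown ULift.down_surjective

/-! ### The ideal `conv` and accumulation points -/

/-- A subset of `ℚ ∩ [0,1]` that is almost contained in each neighbourhood of a point of `[0,1]`
belongs to `conv`. -/
theorem mem_convIdeal_of_almost_subset {A : Set (Icc (0 : ℚ) 1)} {x : ℝ} (hx : x ∈ Icc (0 : ℝ) 1)
    (h : ∀ U ∈ 𝓝 x, {a ∈ A | ((a : ℚ) : ℝ) ∉ U}.Finite) : A ∈ convIdeal := by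
  by_cases hA : A.Finite
  · obtain ⟨n, s, hs⟩ := hA.fin_param
    refine ⟨n, fun i _ => s i, fun i => ⟨((s i : ℚ) : ℝ), ?_, tendsto_const_nhds⟩, ?_⟩
    · exact ⟨by exact_mod_cast (s i).2.1, by exact_mod_cast (s i).2.2⟩
    · rw [← hs.2]
      rintro _ ⟨i, rfl⟩
      exact mem_iUnion.2 ⟨i, 0, rfl⟩
  · have : Infinite A := infinite_coe_iff.2 hA
    obtain ⟨e⟩ : Nonempty (ℕ ≃ A) := nonempty_equiv_of_countable
    refine ⟨1, fun _ k => e k, fun _ => ⟨x, hx, fun U hU => ?_⟩, fun a ha => ?_⟩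
    · rw [← Nat.cofinite_eq_atTop, mem_map, mem_cofinite]
      refine ((h U hU).preimage (f := fun k => (e k : Icc (0 : ℚ) 1))
        (Subtype.val_injective.comp e.injective).injOn).subset fun k hk => ⟨(e k).2, hk⟩
    · exact mem_iUnion.2 ⟨0, e.symm ⟨a, ha⟩, by simp⟩

theorem not_katetovLE_conv_of_finBW (h : FinBW 𝓕 ρ (Icc (0 : ℝ) 1)) :
    ¬ KatetovLE (coideal convIdeal) (rhoOfIdeal convIdeal) 𝓕 ρ := by
  rintro ⟨f, hf⟩
  have hmem (q : Icc (0 : ℚ) 1) : ((q : ℚ) : ℝ) ∈ Icc (0 : ℝ) 1 :=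
    ⟨by exact_mod_cast q.2.1, by exact_mod_cast q.2.2⟩
  obtain ⟨F, hF, x, hx⟩ := h fun a => ⟨((f a : ℚ) : ℝ), hmem _⟩
  obtain ⟨F₂, hF₂, h₂⟩ := hf F hF
  refine hF₂ (mem_convIdeal_of_almost_subset x.2 fun U hU => ?_)
  obtain ⟨K, hK⟩ := hx.comp continuous_subtype_val.continuousAt U hU
  obtain ⟨K₂, hK₂⟩ := h₂ K
  refine K₂.finite_toSet.subset fun a ha => ?_
  by_contra haK
  obtain ⟨b, hb, rfl⟩ := hK₂ ⟨ha.1, haK⟩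
  exact ha.2 (hK ⟨b, hb, rfl⟩)

theorem eventually_notMem_range_of_tendsto {X : Type*} [TopologicalSpace X] [T2Space X]
    {s : ℕ → X} {p x : X} (hs : Tendsto s atTop (𝓝 p)) (hx : x ≠ p) :
    ∀ᶠ y in 𝓝[≠] x, y ∉ range s := by
  obtain ⟨U, V, hU, hV, hUV⟩ := t2_separation_nhds hx
  obtain ⟨N, hN⟩ := eventually_atTop.1 (hs.eventually hV)
  have hfin : ((s '' Iio N) \ {x})ᶜ ∈ 𝓝 x :=
    (((finite_Iio N).image s).sdiff.isClosed.isOpen_compl).mem_nhds fun h => h.2 rfl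
  filter_upwards [nhdsWithin_le_nhds hU, nhdsWithin_le_nhds hfin, self_mem_nhdsWithin]
    with y hyU hy hne
  rintro ⟨k, rfl⟩
  rcases lt_or_ge k N with hk | hk
  · exact hy ⟨⟨k, hk, rfl⟩, hne⟩
  · exact hUV.le_bot ⟨hyU, hN k hk⟩

/-- A member of `conv` has only finitely many accumulation points. -/
theorem finite_accPt_of_mem_convIdeal {A : Set (Icc (0 : ℚ) 1)} (hA : A ∈ convIdeal) :
    {x : ℝ | AccPt x (𝓟 ((fun q : Icc (0 : ℚ) 1 => ((q : ℚ) : ℝ)) '' A))}.Finite := by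
  obtain ⟨n, s, hs, hAs⟩ := hA
  choose p _ hp using hs
  refine (finite_range p).subset fun x hx => ?_
  by_contra hxp
  have h : ∀ᶠ y in 𝓝[≠] x, ∀ i, y ∉ range fun k => ((s i k : ℚ) : ℝ) :=
    eventually_all.2 fun i =>
      eventually_notMem_range_of_tendsto (hp i) fun h => hxp ⟨i, h.symm⟩
  rw [mem_ofPred_eq, accPt_iff_frequently_nhdsNE] at hx
  obtain ⟨_, ⟨q, hq, rfl⟩, hy⟩ := (hx.and_eventually h).exists
  obtain ⟨i, k, rfl⟩ := mem_iUnion.1 (hAs hq)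
  exact hy i ⟨k, rfl⟩

/-- A diagonal set for a decreasing sequence of sets with infinitely many common accumulation
points. -/
theorem exists_notMem_convIdeal_almost_subset {B : ℕ → Set (Icc (0 : ℚ) 1)} {C : Set ℝ}
    (hC : C.Infinite)
    (hCB : ∀ x ∈ C, ∀ n, AccPt x (𝓟 ((fun q : Icc (0 : ℚ) 1 => ((q : ℚ) : ℝ)) '' B n))) :
    ∃ A, A ∉ convIdeal ∧ ∃ b : ℕ → Icc (0 : ℚ) 1, A = range b ∧ ∀ k, b k ∈ B k := by
  have x := hC.natEmbedding
  -- `k.unpair.1` takes each value infinitely often, so a single sequence approaches every chosen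
  -- point.
  have h (k : ℕ) : ∃ b ∈ B k, ((b : ℚ) : ℝ) ≠ x k.unpair.1 ∧
      dist ((b : ℚ) : ℝ) (x k.unpair.1) < 1 / ((k : ℝ) + 1) := by
    obtain ⟨_, ⟨hy, b, hb, rfl⟩, hne⟩ := accPt_iff_nhds.1 (hCB _ (x k.unpair.1).2 k) _
      (Metric.ball_mem_nhds _ (Nat.one_div_pos_of_nat (n := k)))
    exact ⟨b, hb, hne, hy⟩
  choose b hbB hne hdist using h
  refine ⟨range b, fun hA => ?_, b, rfl, hbB⟩
  refine (infinite_range_of_injective (Subtype.val_injective.comp x.injective))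
    ((finite_accPt_of_mem_convIdeal hA).subset ?_)
  rintro _ ⟨i, rfl⟩
  refine accPt_iff_nhds.2 fun U hU => ?_
  obtain ⟨ε, hε, hεU⟩ := Metric.mem_nhds_iff.1 hU
  obtain ⟨N, hN⟩ := exists_nat_one_div_lt hε
  have hd := hdist (Nat.pair i N)
  have hn := hne (Nat.pair i N)
  rw [Nat.unpair_pair] at hd hn
  refine ⟨_, ⟨hεU (hd.trans (lt_of_le_of_lt ?_ hN)), _, mem_range_self (Nat.pair i N), rfl⟩, hn⟩
  exact Nat.one_div_le_one_div (Nat.right_le_pair i N)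

/-! ### Exhaustion and rational approximation -/

theorem exists_finset_exhaustion (Ω : Type*) [Countable Ω] :
    ∃ K : ℕ → Finset Ω, ∀ L : Finset Ω, ∃ N, ∀ n ≥ N, L ⊆ K n := by
  classical
  obtain ⟨e, he⟩ := exists_injective_nat Ω
  refine ⟨fun n => ((finite_Iio n).preimage he.injOn).toFinset, fun L => ⟨L.sup e + 1, ?_⟩⟩
  intro n hn a ha
  have := Finset.le_sup (f := e) ha
  simp only [Finite.mem_toFinset, mem_preimage, mem_Iio]
  omega

/-- Every function to `[0,1]` is approximated by a function to `ℚ ∩ [0,1]`, up to an error that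
tends to zero along the finite sets. -/
theorem exists_rat_approx {Λ : Type*} [Countable Λ] (f : Λ → Icc (0 : ℝ) 1) :
    ∃ g : Λ → Icc (0 : ℚ) 1,
      ∀ ε > 0, {a | ε ≤ dist ((g a : ℚ) : ℝ) (f a : ℝ)}.Finite := by
  obtain ⟨e, he⟩ := exists_injective_nat Λ
  have h (a : Λ) : ∃ q : Icc (0 : ℚ) 1,
      dist ((q : ℚ) : ℝ) (f a : ℝ) < 1 / ((e a : ℝ) + 1) := by
    have hpos : (0 : ℝ) < 1 / ((e a : ℝ) + 1) := Nat.one_div_pos_of_nat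
    obtain ⟨h0, h1⟩ := (f a).2
    obtain ⟨q, hq1, hq2⟩ := exists_rat_btwn (show
      max 0 ((f a : ℝ) - 1 / ((e a : ℝ) + 1) / 2) <
        min 1 ((f a : ℝ) + 1 / ((e a : ℝ) + 1) / 2) by
      rw [max_lt_iff, lt_min_iff, lt_min_iff]
      refine ⟨⟨?_, ?_⟩, ?_, ?_⟩ <;> linarith)
    rw [max_lt_iff] at hq1
    rw [lt_min_iff] at hq2
    refine ⟨⟨q, by exact_mod_cast hq1.1.le, by exact_mod_cast hq2.1.le⟩, ?_⟩
    rw [Real.dist_eq, abs_lt]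
    constructor <;> simp only <;> linarith [hq1.2, hq2.2]
  choose g hg using h
  refine ⟨g, fun ε hε => ?_⟩
  obtain ⟨N, hN⟩ := exists_nat_one_div_lt hε
  refine ((finite_Iio N).preimage he.injOn).subset fun a ha => ?_
  by_contra hlt
  have hle : N ≤ e a := not_lt.1 hlt
  have := Nat.one_div_le_one_div (α := ℝ) hle
  exact absurd ha (not_le.2 ((hg a).trans_le (this.trans hN.le)))

/-- For each tolerance, (S) allows the finitely many points where `h` and `f` are far apart to be
discarded. -/
theorem IsPartitionRegular.exists_rhoConvergesTo_of_approx (hρ : IsPartitionRegular 𝓕 ρ)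
    {X : Type*} [PseudoMetricSpace X] {f h : Λ → X}
    (hfh : ∀ ε > 0, {a | ε ≤ dist (h a) (f a)}.Finite) {E : Set Ω} (hE : E ∈ 𝓕) {x : X}
    (hx : RhoConvergesTo ρ h E x) : ∃ F ∈ 𝓕, RhoConvergesTo ρ f F x := by
  obtain ⟨F, hF, hFE, hS⟩ := hρ.sparse E hE
  refine ⟨F, hF, fun U hU => ?_⟩
  obtain ⟨ε, hε, hεU⟩ := Metric.mem_nhds_iff.1 hU
  obtain ⟨K, hK⟩ := hρ.rhoConvergesTo_mono hF hE hFE hx _ (Metric.ball_mem_nhds x (half_pos hε))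
  obtain ⟨L, hKL, hL⟩ := hρ.exists_value_diff_disjoint hF hS K (hfh _ (half_pos hε))
  refine ⟨L, ?_⟩
  rintro _ ⟨a, ha, rfl⟩
  have h1 : dist (h a) x < ε / 2 :=
    hK ⟨a, hρ.value_diff_subset hF hF subset_rfl hKL ha, rfl⟩
  have h2 : dist (h a) (f a) < ε / 2 := not_le.1 (hL a ha)
  refine hεU (Metric.mem_ball.2 ?_)
  linarith [dist_triangle_left (f a) x (h a)]

/-! ### Cluster sets modulo the ideal -/

/-- The set of points each neighbourhood of which has an `I_ρ`-positive preimage in `ρ F`. -/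
def rhoClusterSet {X : Type*} [TopologicalSpace X] (𝓕 : Set (Set Ω)) (ρ : Set Ω → Set Λ)
    (h : Λ → X) (F : Set Ω) : Set X :=
  {x | ∀ U ∈ 𝓝 x, ρ F ∩ h ⁻¹' U ∉ rhoIdeal 𝓕 ρ}

/-- Finitely many neighbourhoods with preimage in the ideal cover `s`, and (R) closes the ideal
under finite unions. -/
theorem IsPartitionRegular.inter_preimage_mem_rhoIdeal (hρ : IsPartitionRegular 𝓕 ρ) {X : Type*}
    [TopologicalSpace X] {h : Λ → X} {F : Set Ω} {s : Set X} (hs : IsCompact s)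
    (hd : ∀ x ∈ s, x ∉ rhoClusterSet 𝓕 ρ h F) : ρ F ∩ h ⁻¹' s ∈ rhoIdeal 𝓕 ρ := by
  refine hs.induction_on (p := fun t => ρ F ∩ h ⁻¹' t ∈ rhoIdeal 𝓕 ρ) ?_ ?_ ?_ ?_
  · simpa using hρ.empty_mem_rhoIdeal
  · intro t t' htt' ht'
    exact rhoIdeal_mono ht' (inter_subset_inter_right _ (preimage_mono htt'))
  · intro t t' ht ht'
    rw [preimage_union, inter_union_distrib_left]
    exact hρ.union_mem_rhoIdeal ht ht'
  · intro x hx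
    have := hd x hx
    simp only [rhoClusterSet, mem_ofPred_eq, not_forall, not_not] at this
    obtain ⟨U, hU, hUI⟩ := this
    exact ⟨U, mem_nhdsWithin_of_mem_nhds hU, hUI⟩

/-- Under `P⁻`, an isolated point of the cluster set is a `ρ`-limit. -/
theorem IsPartitionRegular.exists_rhoConvergesTo_of_isolated (hρ : IsPartitionRegular 𝓕 ρ)
    (hP : PMinus 𝓕 ρ) {X : Type*} [MetricSpace X] [ProperSpace X] {h : Λ → X} {F : Set Ω} {c : X}
    (hc : c ∈ rhoClusterSet 𝓕 ρ h F) {δ : ℝ} (hδ : 0 < δ)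
    (hiso : ∀ x ∈ rhoClusterSet 𝓕 ρ h F, x ∈ Metric.closedBall c δ → x = c) :
    ∃ E ∈ 𝓕, RhoConvergesTo ρ h E c := by
  have hpos (n : ℕ) : 0 < δ / ((n : ℝ) + 1) := by positivity
  have hanti : Antitone fun n : ℕ => Metric.ball c (δ / ((n : ℝ) + 1)) := fun m n hmn =>
    Metric.ball_subset_ball (by gcongr)
  -- Successive differences lie over a closed ball minus a smaller open ball: a compact set missing
  -- the cluster set.
  obtain ⟨E, hE, -, hconv⟩ := hP (fun n => ρ F ∩ h ⁻¹' Metric.ball c (δ / ((n : ℝ) + 1)))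
    (fun m n hmn => inter_subset_inter_right _ (preimage_mono (hanti hmn)))
    (hc _ (Metric.ball_mem_nhds _ (hpos 0))) (fun n => by
      refine rhoIdeal_mono (hρ.inter_preimage_mem_rhoIdeal (h := h) (F := F)
        ((isCompact_closedBall c δ).diff
          (Metric.isOpen_ball (x := c) (ε := δ / (((n + 1 : ℕ) : ℝ) + 1)))) ?_) ?_
      · rintro x ⟨hx, hx'⟩ hxC
        obtain rfl := hiso x hxC hx
        exact hx' (Metric.mem_ball_self (hpos _))
      · rintro a ⟨⟨haF, ha⟩, ha'⟩
        refine ⟨haF, ?_, fun h' => ha' ⟨haF, h'⟩⟩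
        have : h a ∈ Metric.ball c (δ / (((0 : ℕ) : ℝ) + 1)) := hanti (Nat.zero_le n) ha
        exact Metric.ball_subset_closedBall (by simpa using this))
  refine ⟨E, hE, fun U hU => ?_⟩
  obtain ⟨ε, hε, hεU⟩ := Metric.mem_nhds_iff.1 hU
  obtain ⟨N, hN⟩ := exists_nat_one_div_lt (div_pos hε hδ)
  obtain ⟨K, hK⟩ := hconv N
  refine ⟨K, ?_⟩
  rintro _ ⟨a, ha, rfl⟩
  refine hεU (Metric.ball_subset_ball ?_ (hK ha).2)
  rw [lt_div_iff₀ hδ] at hN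
  rw [div_eq_mul_one_div, mul_comm]
  exact hN.le

/-- If `h` has no `ρ`-limit, then it sends `I_ρ`-positive sets to infinite sets. -/
theorem IsPartitionRegular.infinite_image (hρ : IsPartitionRegular 𝓕 ρ) {X : Type*}
    [TopologicalSpace X] {h : Λ → X} (hno : ∀ E ∈ 𝓕, ∀ x, ¬ RhoConvergesTo ρ h E x)
    {A : Set Λ} (hA : A ∉ rhoIdeal 𝓕 ρ) : (h '' A).Infinite := by
  intro hfin
  refine hA (rhoIdeal_mono (B := h ⁻¹' (h '' A)) ?_ (subset_preimage_image h A))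
  refine hfin.induction_on (motive := fun s _ => h ⁻¹' s ∈ rhoIdeal 𝓕 ρ) _ ?_ ?_
  · simpa using hρ.empty_mem_rhoIdeal
  · intro x s _ _ hs
    -- Each fibre is in the ideal: a value ρ(E) inside it would make `h` constant there, hence
    -- ρ-convergent.
    rw [insert_eq, preimage_union]
    refine hρ.union_mem_rhoIdeal (fun E hE hsub => hno E hE x fun U hU => ⟨∅, ?_⟩) hs
    rintro _ ⟨a, ha, rfl⟩
    have : h a = x := hsub (hρ.value_diff_subset_self hE ∅ ha)
    exact this ▸ mem_of_mem_nhds hU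

/-- Small accretions let ρ(F \ K) replace ρ(F) modulo the ideal; positive sets have infinite image,
hence a point other than `x`. -/
theorem IsPartitionRegular.accPt_of_mem_rhoClusterSet (hρ : IsPartitionRegular 𝓕 ρ) {X : Type*}
    [TopologicalSpace X] {h : Λ → X} (hno : ∀ E ∈ 𝓕, ∀ x, ¬ RhoConvergesTo ρ h E x)
    {F : Set Ω} (hacc : SetHasSmallAccretions 𝓕 ρ F) {x : X}
    (hx : x ∈ rhoClusterSet 𝓕 ρ h F) (K : Finset Ω) :
    AccPt x (𝓟 (h '' ρ (F \ (K : Set Ω)))) := by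
  refine accPt_iff_nhds.2 fun U hU => ?_
  have hpos : ρ (F \ (K : Set Ω)) ∩ h ⁻¹' U ∉ rhoIdeal 𝓕 ρ := by
    intro hI
    refine hx U hU (rhoIdeal_mono (hρ.union_mem_rhoIdeal (hacc K) hI) ?_)
    rintro a ⟨haF, haU⟩
    by_cases ha : a ∈ ρ (F \ (K : Set Ω))
    · exact Or.inr ⟨ha, haU⟩
    · exact Or.inl ⟨haF, ha⟩
  obtain ⟨_, ⟨a, ha, rfl⟩, hne⟩ := (hρ.infinite_image hno hpos).exists_notMem_finite
    (finite_singleton x)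
  exact ⟨h a, ⟨ha.2, mem_image_of_mem _ ha.1⟩, hne⟩

/-- By compactness the cluster set is nonempty; were it finite, its points would be isolated and
hence ρ-limits. -/
theorem IsPartitionRegular.infinite_rhoClusterSet (hρ : IsPartitionRegular 𝓕 ρ)
    (hP : PMinus 𝓕 ρ) {X : Type*} [MetricSpace X] [ProperSpace X] {h : Λ → X} {s : Set X}
    (hs : IsCompact s) (hmem : ∀ a, h a ∈ s) (hno : ∀ E ∈ 𝓕, ∀ x, ¬ RhoConvergesTo ρ h E x)
    {F : Set Ω} (hF : F ∈ 𝓕) : (rhoClusterSet 𝓕 ρ h F).Infinite := by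
  intro hfin
  obtain ⟨c, hc⟩ : (rhoClusterSet 𝓕 ρ h F).Nonempty := by
    by_contra hne
    rw [not_nonempty_iff_eq_empty] at hne
    refine value_notMem_rhoIdeal hF (rhoIdeal_mono (hρ.inter_preimage_mem_rhoIdeal (h := h)
      (F := F) hs fun x _ => by simp [hne]) fun a ha => ⟨ha, hmem a⟩)
  have hnhds : (rhoClusterSet 𝓕 ρ h F \ {c})ᶜ ∈ 𝓝 c :=
    hfin.sdiff.isClosed.isOpen_compl.mem_nhds fun h => h.2 rfl
  obtain ⟨δ, hδ, hsub⟩ := Metric.nhds_basis_closedBall.mem_iff.1 hnhds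
  obtain ⟨E, hE, hconv⟩ := hρ.exists_rhoConvergesTo_of_isolated hP hc hδ fun x hx hxδ => by
    by_contra hne
    exact hsub hxδ ⟨hx, hne⟩
  exact hno E hE c hconv

theorem IsPartitionRegular.katetovLE_conv_of_not_finBW [Countable Ω] [Countable Λ]
    (hρ : IsPartitionRegular 𝓕 ρ) (hacc : HasSmallAccretions 𝓕 ρ) (hP : PMinus 𝓕 ρ)
    (hbw : ¬ FinBW 𝓕 ρ (Icc (0 : ℝ) 1)) :
    KatetovLE (coideal convIdeal) (rhoOfIdeal convIdeal) 𝓕 ρ := by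
  classical
  simp only [FinBW, not_forall] at hbw
  obtain ⟨f, hf⟩ := hbw
  obtain ⟨g, hg⟩ := exists_rat_approx f
  let h : Λ → Icc (0 : ℝ) 1 := fun a =>
    ⟨((g a : ℚ) : ℝ), by exact_mod_cast (g a).2.1, by exact_mod_cast (g a).2.2⟩
  have hno : ∀ E ∈ 𝓕, ∀ x, ¬ RhoConvergesTo ρ h E x := by
    intro E hE x hx
    obtain ⟨F, hF, hconv⟩ := hρ.exists_rhoConvergesTo_of_approx (f := f) (h := h) hg hE hx
    exact hf ⟨F, hF, x, hconv⟩
  obtain ⟨K, hK⟩ := exists_finset_exhaustion Ω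
  refine ⟨g, fun F₁ hF₁ => ?_⟩
  obtain ⟨F, hF, hFF₁, hFacc⟩ := hacc F₁ hF₁
  have hinf := hρ.infinite_rhoClusterSet hP isCompact_univ (fun a => mem_univ (h a)) hno hF
  obtain ⟨A, hA, b, rfl, hb⟩ := exists_notMem_convIdeal_almost_subset
    (B := fun n => g '' ρ (F \ (K n : Set Ω)))
    (hinf.image (f := Subtype.val) Subtype.val_injective.injOn) (by
      rintro _ ⟨x, hx, rfl⟩ n
      have := (hρ.accPt_of_mem_rhoClusterSet hno hFacc hx (K n)).map
        continuous_subtype_val.continuousAt Subtype.val_injective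
      rw [map_principal, image_image] at this
      rw [image_image]
      exact this)
  refine ⟨range b, hA, fun K₁ => ?_⟩
  obtain ⟨N, hN⟩ := hK K₁
  -- Only the terms with index below `N` can escape, as `K n` contains `K₁` from `N` on.
  refine ⟨(Finset.range N).image b, ?_⟩
  rintro _ ⟨⟨k, rfl⟩, hk⟩
  have hNk : N ≤ k := by
    by_contra hlt
    exact hk (Finset.mem_coe.2 (Finset.mem_image_of_mem b (Finset.mem_range.2 (not_le.1 hlt))))
  exact image_mono (hρ.value_diff_subset hF hF₁ hFF₁ (hN k hNk)) (hb k)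

end

theorem mainTheorem5 {Ω : Type u} {Λ : Type v} [Countable Ω] [Infinite Ω]
    [Countable Λ] [Infinite Λ] (𝓕 : Set (Set Ω)) (ρ : Set Ω → Set Λ)
    (hρ : IsPartitionRegular 𝓕 ρ) (hacc : HasSmallAccretions 𝓕 ρ) :
    (PMinus 𝓕 ρ →
      List.TFAE
        [∀ (X : Type w) [MetricSpace X], FinBW 𝓕 ρ X ↔ CompactSpace X,
         FinBW 𝓕 ρ (Set.Icc (0 : ℝ) 1),
         ¬ KatetovLE (coideal convIdeal) (rhoOfIdeal convIdeal) 𝓕 ρ]) ∧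
    -- without assuming `P⁻`, only the implication from the third to the second condition is lost
    ((∀ (X : Type w) [MetricSpace X], FinBW 𝓕 ρ X ↔ CompactSpace X) ↔
      FinBW 𝓕 ρ (Set.Icc (0 : ℝ) 1)) ∧
    (FinBW 𝓕 ρ (Set.Icc (0 : ℝ) 1) →
      ¬ KatetovLE (coideal convIdeal) (rhoOfIdeal convIdeal) 𝓕 ρ) := by
  have h12 := hρ.forall_finBW_iff_compactSpace_iff
  refine ⟨fun hP => ?_, h12, not_katetovLE_conv_of_finBW⟩
  tfae_have 1 ↔ 2 := h12
  tfae_have 2 → 3 := not_katetovLE_conv_of_finBW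
  tfae_have 3 → 2 := fun h => by
    by_contra hbw
    exact h (hρ.katetovLE_conv_of_not_finBW hacc hP hbw)
  tfae_finish
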